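/- Let $d\ge 1$. For $f\in L^1(\mathbb R^d)$ put $\widehat f(y)=\int_{\mathbb R^d} f(x)e^{-2\pi i x\cdot y}\,dx$. For a function $g:\mathbb R^d\to\mathbb C$ let $$A(g):=\inf\{r>0:\ g(x)\ge 0 \text{ whenever } |x|>r\}\in[0,\infty],\qquad \inf\emptyset=\infty,$$ where $g(x)\ge 0$ means that $g(x)$ is real and nonnegative. Let $\mathcal A$ be the set of nonzero integrable functions $f:\mathbb R^d\to\mathbb R$ with $\widehat f\in L^1(\mathbb R^d)$, $f(0)\le 0$ and $\widehat f(0)\le 0$, where such $f$ is identified with its continuous representative, and put $$\mathbf A:=\inf_{f\in\mathcal A}\sqrt{A(f)\,A(\widehat f)}.$$ Then $0<\mathbf A<\infty$, and the sharp inequality $A(f)A(\widehat f)\ge \mathbf A^2$ $(f\in\mathcal A)$ has an extremizer. Namely, there is a nonzero radial function $f:\mathbb R^d\to\mathbb R$, $f\in L^1(\mathbb R^d)$, such that $\widehat f=f$ everywhere, $f(0)=\widehat f(0)=0$ and $A(f)=\mathbf A$; in particular $f\in\mathcal A$ and $A(f)A(\widehat f)=\mathbf A^2$. -/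

import Mathlib

open MeasureTheory FourierTransform
open scoped ENNReal

noncomputable section

namespace RootUncertainty

/-- Euclidean space `ℝᵈ`. -/
abbrev E (d : ℕ) : Type := EuclideanSpace ℝ (Fin d)

/-- The Fourier transform `f̂(y) = ∫ f(x) e^{-2πi x·y} dx` of a real-valued function on `ℝᵈ`.
It is complex-valued in general. -/
def hat {d : ℕ} (f : E d → ℝ) : E d → ℂ :=
  𝓕 (fun x => (f x : ℂ))

/-- `A(g) = inf {r > 0 : g(x) ≥ 0 if |x| > r}`, an element of `[0, ∞]`, equal to `∞` if there is no
such `r`. For a complex value, `g(x) ≥ 0` means that `g(x)` is real and nonnegative. -/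
def A {d : ℕ} (g : E d → ℂ) : ℝ≥0∞ :=
  ⨅ r ∈ {r : ℝ | 0 < r ∧ ∀ x : E d, r < ‖x‖ → 0 ≤ (g x).re ∧ (g x).im = 0}, ENNReal.ofReal r

/-- The quantity `A(f)` for a real-valued function `f`. -/
def AReal {d : ℕ} (f : E d → ℝ) : ℝ≥0∞ :=
  A (fun x => (f x : ℂ))

/-- The class `𝒜`. An integrable function with integrable Fourier transform agrees almost everywhere
with exactly one continuous function; since the conditions on `f(0)` and the quantity `A(f)` concern
pointwise values, `f` is taken to be that continuous representative.
The number `f̂(0) = ∫ f` is real, so `f̂(0) ≤ 0` is a condition on its real part. -/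
structure IsAdmissible {d : ℕ} (f : E d → ℝ) : Prop where
  continuous : Continuous f
  ne_zero : f ≠ 0
  integrable : Integrable f
  integrable_hat : Integrable (hat f)
  apply_zero_nonpos : f 0 ≤ 0
  hat_zero_nonpos : (hat f 0).re ≤ 0

/-- The sharp constant `𝐀 = inf_{f ∈ 𝒜} √(A(f) A(f̂))` in dimension `d`. -/
def sharpConst (d : ℕ) : ℝ≥0∞ :=
  ⨅ f ∈ {f : E d → ℝ | IsAdmissible f}, (AReal f * A (hat f)) ^ (1 / 2 : ℝ)

/-- A function on `ℝᵈ` is radial if its value at `x` depends only on `|x|`. -/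
def IsRadial {d : ℕ} (f : E d → ℝ) : Prop :=
  ∀ x y : E d, ‖x‖ = ‖y‖ → f x = f y

end RootUncertainty

end

/-! The problem reduces to self-dual functions. The product `A(f) A(f̂)` is invariant under
dilation, so both radii may be taken equal to `√(rs)`. Then `f(x) + f(-x) + 2 Re f̂(x)` is its own
Fourier transform and keeps all the sign conditions. It is nonzero: cancellation would make `f` and
`f̂` both compactly supported, which forces `f = 0`. Hence the sharp constant is the least radius of
a nonzero self-dual function.

This least radius is attained by weak compactness. Self-duality gives `‖f‖_∞ ≤ ‖f‖₁`, so an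
`L¹`-normalised minimising sequence is bounded in `L²`. Every constraint passes to a weak limit
(`exists_isSelfDual_weakTendsto`). The limit is not zero (`not_weakTendsto_zero`), because a
nonpositive integral bounds the mass outside the ball by the mass inside it.

Radial symmetry comes from strict convexity. At the optimal radius, the self-dual function with mass
`-1` on the ball and least `L²` norm is unique, hence invariant under isometries. Finally `f(0) =
0`, since otherwise adding a multiple of the self-dual Gaussian would shrink the radius. -/

open Filter Topology

/-! ### Weak compactness in `L²` -/

namespace RootUncertainty

/-- Weak convergence of a sequence of functions against square-integrable test functions. -/
def WeakTendsto {α : Type*} [MeasurableSpace α] (μ : Measure α) (f : ℕ → α → ℝ) (g : α → ℝ) : Prop :=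
  ∀ h : α → ℝ, MemLp h 2 μ →
    Tendsto (fun n => ∫ x, f n x * h x ∂μ) atTop (𝓝 (∫ x, g x * h x ∂μ))

/-- Bounded sequences in a separable `L²` have weakly convergent subsequences. -/
theorem exists_weakTendsto {α : Type*} [MeasurableSpace α] {μ : Measure α}
    [IsSeparable μ]
    {f : ℕ → α → ℝ} (hf : ∀ n, MemLp (f n) 2 μ) {C : ℝ} (hC : ∀ n, ∫ x, f n x ^ 2 ∂μ ≤ C) :
    ∃ g : α → ℝ, StronglyMeasurable g ∧ MemLp g 2 μ ∧ ∃ φ : ℕ → ℕ, StrictMono φ ∧ WeakTendsto μ (f ∘ φ) g := by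
  have : Fact ((2 : ℝ≥0∞) ≠ ∞) := ⟨ENNReal.ofNat_ne_top⟩
  set F : ℕ → Lp ℝ 2 μ := fun n => (hf n).toLp (f n)
  have hinner : ∀ (u v : α → ℝ) (hu : MemLp u 2 μ) (hv : MemLp v 2 μ),
      inner ℝ (hu.toLp u) (hv.toLp v) = ∫ x, u x * v x ∂μ := by
    intro u v hu hv
    rw [L2.inner_def]
    refine integral_congr_ae ?_
    filter_upwards [hu.coeFn_toLp, hv.coeFn_toLp] with x h1 h2
    rw [h1, h2]
    simp [mul_comm]
  have hnorm : ∀ n, ‖F n‖ ≤ Real.sqrt C := by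
    intro n
    apply Real.le_sqrt_of_sq_le
    rw [← real_inner_self_eq_norm_sq, hinner]
    simpa [sq] using hC n
  let ℓ : ℕ → WeakDual ℝ (Lp ℝ 2 μ) := fun n =>
    StrongDual.toWeakDual (InnerProductSpace.toDual ℝ _ (F n))
  obtain ⟨a, -, φ, hφ, hlim⟩ := WeakDual.isSeqCompact_closedBall ℝ (Lp ℝ 2 μ) 0 (Real.sqrt C)
    (x := ℓ) (fun n => by simpa [ℓ] using hnorm n)
  set G : Lp ℝ 2 μ := (InnerProductSpace.toDual ℝ _).symm (WeakDual.toStrongDual a)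
  refine ⟨G, Lp.stronglyMeasurable G, Lp.memLp G, φ, hφ, fun h hh => ?_⟩
  have h1 : Tendsto (fun n => (ℓ ∘ φ) n (hh.toLp h)) atTop (𝓝 (a (hh.toLp h))) :=
    ((WeakDual.eval_continuous (hh.toLp h)).tendsto a).comp hlim
  have h2 : ∀ n, (ℓ ∘ φ) n (hh.toLp h) =
      ∫ x, (f ∘ φ) n x * h x ∂μ := by
    intro n
    exact InnerProductSpace.toDual_apply_apply.trans (hinner _ _ (hf (φ n)) hh)
  have h3 : a (hh.toLp h) = ∫ x, G x * h x ∂μ := by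
    rw [← hinner _ _ (Lp.memLp G) hh, Lp.toLp_coeFn]
    exact (InnerProductSpace.toDual_symm_apply (𝕜 := ℝ) (y := WeakDual.toStrongDual a)).symm
  simpa only [h2, h3] using h1

/-! ### The Fourier transform of real functions -/

variable {d : ℕ}

theorem hat_apply (f : E d → ℝ) (y : E d) :
    hat f y = ∫ x, Complex.exp (↑(-2 * Real.pi * inner ℝ x y) * Complex.I) * (f x : ℂ) := by
  simp only [hat, Real.fourier_eq', smul_eq_mul]

theorem continuous_fourier_of_integrable {f : E d → ℂ} (hf : Integrable f) : Continuous (𝓕 f) :=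
  VectorFourier.fourierIntegral_continuous Real.continuous_fourierChar
    (by exact continuous_inner) hf

theorem continuous_hat {f : E d → ℝ} (hf : Integrable f) : Continuous (hat f) :=
  continuous_fourier_of_integrable hf.ofReal

theorem hat_zero (f : E d → ℝ) : hat f 0 = ((∫ x, f x : ℝ) : ℂ) := by
  simp [hat_apply, integral_complex_ofReal]

theorem hat_re {f : E d → ℝ} (hf : Integrable f) (y : E d) :
    (hat f y).re = ∫ x, f x * Real.cos (2 * Real.pi * inner ℝ x y) := by
  have hint : Integrable
      (fun x => Complex.exp (↑(-2 * Real.pi * inner ℝ x y) * Complex.I) * (f x : ℂ)) := by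
    refine hf.ofReal.bdd_mul (c := 1) (by fun_prop) (ae_of_all _ fun x => ?_)
    rw [Complex.norm_exp_ofReal_mul_I]
  rw [hat_apply]
  have := integral_re hint
  simp only [RCLike.re_eq_complex_re] at this
  rw [← this]
  refine integral_congr_ae (ae_of_all _ fun x => ?_)
  simp only [Complex.re_mul_ofReal, Complex.exp_ofReal_mul_I_re]
  rw [mul_comm]
  congr 1
  rw [← Real.cos_neg]
  ring_nf

theorem hat_im {f : E d → ℝ} (hf : Integrable f) (y : E d) :
    (hat f y).im = ∫ x, f x * -Real.sin (2 * Real.pi * inner ℝ x y) := by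
  have hint : Integrable
      (fun x => Complex.exp (↑(-2 * Real.pi * inner ℝ x y) * Complex.I) * (f x : ℂ)) := by
    refine hf.ofReal.bdd_mul (c := 1) (by fun_prop) (ae_of_all _ fun x => ?_)
    rw [Complex.norm_exp_ofReal_mul_I]
  rw [hat_apply]
  have := integral_im hint
  simp only [RCLike.im_eq_complex_im] at this
  rw [← this]
  refine integral_congr_ae (ae_of_all _ fun x => ?_)
  simp only [Complex.im_mul_ofReal, Complex.exp_ofReal_mul_I_im]
  rw [mul_comm]
  congr 1
  rw [← Real.sin_neg]
  ring_nf

theorem hat_add {f g : E d → ℝ} (hf : Integrable f) (hg : Integrable g) :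
    hat (f + g) = hat f + hat g := by
  have h := VectorFourier.fourierIntegral_add (L := innerₗ (E d)) Real.continuous_fourierChar
    (by exact continuous_inner) hf.ofReal (𝕜 := ℝ) (E := ℂ) hg.ofReal
  have h2 : (fun x => ((f + g) x : ℂ)) = (fun x => (f x : ℂ)) + fun x => (g x : ℂ) := by
    ext x; simp
  rw [hat, h2]
  exact h

theorem hat_const_mul (c : ℝ) (f : E d → ℝ) (y : E d) :
    hat (fun x => c * f x) y = c * hat f y := by
  rw [hat_apply, hat_apply, ← integral_const_mul]
  congr 1
  ext x
  push_cast
  ring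

theorem hat_comp_isometry (L : E d ≃ₗᵢ[ℝ] E d) (f : E d → ℝ) (y : E d) :
    hat (fun x => f (L x)) y = hat f (L y) :=
  Real.fourier_comp_linearIsometry L (fun x => (f x : ℂ)) y

/-! ### Self-dual functions -/

/-- Self-dual functions, nonpositive at the origin and nonnegative outside the ball of
radius `r`. -/
structure IsSelfDual (r : ℝ) (f : E d → ℝ) : Prop where
  integrable : Integrable f
  hat_eq : hat f = fun x => (f x : ℂ)
  apply_zero_nonpos : f 0 ≤ 0
  nonneg : ∀ x, r < ‖x‖ → 0 ≤ f x

namespace IsSelfDual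

variable {r : ℝ} {f g : E d → ℝ}

theorem continuous (hf : IsSelfDual r f) : Continuous f := by
  have h := continuous_hat hf.integrable
  rw [hf.hat_eq] at h
  exact Complex.continuous_re.comp h

theorem abs_le (hf : IsSelfDual r f) (x : E d) : |f x| ≤ ∫ t, |f t| := by
  have h : ‖hat f x‖ ≤ ∫ t, ‖(f t : ℂ)‖ :=
    VectorFourier.norm_fourierIntegral_le_integral_norm _ _ _ _ _
  rw [hf.hat_eq] at h
  simpa using h

/-- This turns weak convergence into pointwise convergence: values of `f` are themselves integrals
of `f` against bounded functions. -/
theorem eq_integral_cos (hf : IsSelfDual r f) (x : E d) :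
    f x = ∫ t, f t * Real.cos (2 * Real.pi * inner ℝ t x) := by
  rw [← hat_re hf.integrable, hf.hat_eq, Complex.ofReal_re]

theorem integral_eq (hf : IsSelfDual r f) : ∫ x, f x = f 0 := by
  have h := hat_zero f
  rw [hf.hat_eq] at h
  exact (Complex.ofReal_injective h).symm

theorem integral_nonpos (hf : IsSelfDual r f) : ∫ x, f x ≤ 0 :=
  hf.integral_eq.trans_le hf.apply_zero_nonpos

theorem integrable_sq (hf : IsSelfDual r f) : Integrable (fun x => f x ^ 2) := by
  simp only [sq]
  exact hf.integrable.bdd_mul (c := ∫ t, |f t|) hf.continuous.aestronglyMeasurable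
    (ae_of_all _ hf.abs_le)

theorem memLp_two (hf : IsSelfDual r f) : MemLp f 2 :=
  (memLp_two_iff_integrable_sq hf.continuous.aestronglyMeasurable).2 hf.integrable_sq

theorem integral_sq_le (hf : IsSelfDual r f) : ∫ x, f x ^ 2 ≤ (∫ x, |f x|) ^ 2 := by
  rw [sq (∫ x, |f x|), ← integral_const_mul]
  refine integral_mono hf.integrable_sq (hf.integrable.abs.const_mul _) fun x => ?_
  simp only [← sq_abs (f x), sq |f x|]
  exact mul_le_mul_of_nonneg_right (hf.abs_le x) (abs_nonneg _)

theorem mono {s : ℝ} (hf : IsSelfDual r f) (h : r ≤ s) : IsSelfDual s f :=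
  ⟨hf.integrable, hf.hat_eq, hf.apply_zero_nonpos, fun x hx => hf.nonneg x (h.trans_lt hx)⟩

theorem add (hf : IsSelfDual r f) (hg : IsSelfDual r g) : IsSelfDual r (f + g) where
  integrable := hf.integrable.add hg.integrable
  hat_eq := by
    rw [hat_add hf.integrable hg.integrable, hf.hat_eq, hg.hat_eq]
    ext x; simp
  apply_zero_nonpos := add_nonpos hf.apply_zero_nonpos hg.apply_zero_nonpos
  nonneg x hx := add_nonneg (hf.nonneg x hx) (hg.nonneg x hx)

theorem const_mul {c : ℝ} (hc : 0 ≤ c) (hf : IsSelfDual r f) :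
    IsSelfDual r (fun x => c * f x) where
  integrable := hf.integrable.const_mul c
  hat_eq := by
    ext x
    rw [hat_const_mul, hf.hat_eq, Complex.ofReal_mul]
  apply_zero_nonpos := mul_nonpos_of_nonneg_of_nonpos hc hf.apply_zero_nonpos
  nonneg x hx := mul_nonneg hc (hf.nonneg x hx)

theorem comp_isometry (L : E d ≃ₗᵢ[ℝ] E d) (hf : IsSelfDual r f) :
    IsSelfDual r (fun x => f (L x)) where
  integrable := (L.measurePreserving.integrable_comp_emb
    L.toHomeomorph.measurableEmbedding).2 hf.integrable
  hat_eq := by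
    ext x
    rw [hat_comp_isometry, hf.hat_eq]
  apply_zero_nonpos := by simpa using hf.apply_zero_nonpos
  nonneg x hx := hf.nonneg _ (by simpa using hx)

theorem setIntegral_compl_nonneg (hf : IsSelfDual r f) :
    0 ≤ ∫ x in (Metric.closedBall 0 r)ᶜ, f x :=
  setIntegral_nonneg Metric.isClosed_closedBall.measurableSet.compl
    fun x hx => hf.nonneg x (by simpa using hx)

theorem setIntegral_compl_abs (hf : IsSelfDual r f) :
    ∫ x in (Metric.closedBall 0 r)ᶜ, |f x| = ∫ x in (Metric.closedBall 0 r)ᶜ, f x :=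
  setIntegral_congr_fun Metric.isClosed_closedBall.measurableSet.compl
    fun x hx => abs_of_nonneg (hf.nonneg x (by simpa using hx))

theorem setIntegral_add_compl (hf : IsSelfDual r f) (s : ℝ) :
    (∫ x in Metric.closedBall 0 s, f x) + ∫ x in (Metric.closedBall 0 s)ᶜ, f x ≤ 0 := by
  rw [integral_add_compl Metric.isClosed_closedBall.measurableSet hf.integrable]
  exact hf.integral_nonpos

theorem setIntegral_closedBall_nonpos (hf : IsSelfDual r f) :
    ∫ x in Metric.closedBall 0 r, f x ≤ 0 := by
  linarith [hf.setIntegral_add_compl r, hf.setIntegral_compl_nonneg]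

end IsSelfDual

end RootUncertainty

/-! ### Weak limits of self-dual functions -/

namespace RootUncertainty

namespace WeakTendsto

theorem setIntegral {α : Type*} [MeasurableSpace α] {μ : Measure α} {f : ℕ → α → ℝ} {p : α → ℝ}
    (h : WeakTendsto μ f p) {s : Set α} (hs : MeasurableSet s) (hμ : μ s ≠ ∞) :
    Tendsto (fun n => ∫ x in s, f n x ∂μ) atTop (𝓝 (∫ x in s, p x ∂μ)) := by
  have key : ∀ u : α → ℝ, ∫ x in s, u x ∂μ = ∫ x, u x * s.indicator (fun _ => (1 : ℝ)) x ∂μ := by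
    intro u
    rw [← integral_indicator hs]
    congr 1
    ext x
    by_cases hx : x ∈ s <;> simp [hx]
  simp only [key]
  exact h _ (memLp_indicator_const 2 hs 1 (Or.inr hμ))

variable {d : ℕ} {f : ℕ → E d → ℝ} {p : E d → ℝ}

theorem integrable (h : WeakTendsto volume f p) (hpm : StronglyMeasurable p) (hp : MemLp p 2)
    (hf : ∀ n, Integrable (f n)) {M : ℝ} (hM : ∀ n, ∫ x, |f n x| ≤ M) : Integrable p := by
  have hcov : AECover (volume : Measure (E d)) atTop
      (fun k : ℕ => Metric.closedBall (0 : E d) (k : ℝ)) :=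
    aecover_closedBall tendsto_natCast_atTop_atTop
  have hmeas : ∀ k : ℕ, MeasurableSet (Metric.closedBall (0 : E d) (k : ℝ)) := fun k =>
    Metric.isClosed_closedBall.measurableSet
  have hfin : ∀ k : ℕ, volume (Metric.closedBall (0 : E d) (k : ℝ)) ≠ ∞ := fun k =>
    measure_closedBall_lt_top.ne
  refine hcov.integrable_of_integral_norm_bounded M (fun k => ?_) (Eventually.of_forall fun k => ?_)
  · have : IsFiniteMeasure (volume.restrict (Metric.closedBall (0 : E d) (k : ℝ))) :=
      ⟨by simpa using (hfin k).lt_top⟩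
    exact (hp.restrict _).integrable (by norm_num)
  · set B := Metric.closedBall (0 : E d) (k : ℝ)
    -- Testing against the sign of `p` on a ball recovers the `L¹` norm of `p` there, so the `L¹`
    -- bound survives the limit.
    let σ : E d → ℝ := fun x => if 0 ≤ p x then 1 else -1
    have hσm : Measurable σ :=
      Measurable.ite (measurableSet_le measurable_const hpm.measurable)
        measurable_const measurable_const
    have hσ : ∀ x, ‖B.indicator σ x‖ ≤ 1 := by
      intro x
      by_cases hx : x ∈ B
      · by_cases h0 : 0 ≤ p x <;> simp [hx, σ, h0]
      · simp [hx]
    have hmem : MemLp (B.indicator σ) 2 := by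
      refine (memLp_indicator_const (E := ℝ) 2 (hmeas k) 1 (Or.inr (hfin k))).mono
        (hσm.indicator (hmeas k)).aestronglyMeasurable (ae_of_all _ fun x => ?_)
      by_cases hx : x ∈ B
      · rw [Set.indicator_of_mem (f := fun _ => (1 : ℝ)) hx, norm_one]
        exact hσ x
      · rw [Set.indicator_of_notMem hx, Set.indicator_of_notMem hx]
    have hlim := h _ hmem
    have heq : ∫ x, p x * B.indicator σ x = ∫ x in B, ‖p x‖ := by
      have hB : MeasurableSet B := hmeas k
      rw [← integral_indicator hB]
      congr 1
      ext x
      by_cases hx : x ∈ B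
      · by_cases h0 : 0 ≤ p x
        · simp [hx, σ, h0, abs_of_nonneg]
        · simp [hx, σ, h0, abs_of_neg (not_le.1 h0)]
      · simp [hx]
    rw [← heq]
    refine le_of_tendsto hlim (Eventually.of_forall fun n => le_trans ?_ (hM n))
    refine (Real.le_norm_self _).trans (norm_integral_le_of_norm_le (hf n).abs (ae_of_all _ fun x => ?_))
    rw [norm_mul]
    exact mul_le_of_le_one_right (abs_nonneg _) (hσ x)

theorem ae_nonneg (h : WeakTendsto volume f p) (hp : MemLp p 2) {r : ℕ → ℝ} {R : ℝ}
    (hr : Tendsto r atTop (𝓝 R)) (hf : ∀ n, IsSelfDual (r n) (f n)) :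
    ∀ᵐ x : E d, R < ‖x‖ → 0 ≤ p x := by
  have key : ∀ s, R < s → ∀ᵐ x : E d, s < ‖x‖ → 0 ≤ p x := by
    intro s hs
    -- The test function is the negative part of `p` itself beyond `s`. Its pairing with `p` is at
    -- most zero, while the limit makes it at least zero.
    set h₀ : E d → ℝ := (Metric.closedBall 0 s)ᶜ.indicator (fun x => max (-p x) 0)
    have hmem : MemLp h₀ 2 :=
      MemLp.indicator Metric.isClosed_closedBall.measurableSet.compl hp.neg.pos_part
    have hle : 0 ≤ ∫ x, p x * h₀ x := by
      refine ge_of_tendsto (h h₀ hmem) ?_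
      filter_upwards [hr.eventually_lt_const hs] with n hn
      refine integral_nonneg fun x => ?_
      by_cases hx : s < ‖x‖
      · exact mul_nonneg ((hf n).nonneg x (hn.trans hx))
          (Set.indicator_nonneg (fun _ _ => le_max_right _ _) x)
      · simp [h₀, hx]
    have hneg : ∀ x, 0 ≤ -(p x * h₀ x) := by
      intro x
      by_cases hx : s < ‖x‖
      · simp only [h₀, Set.mem_compl_iff, Metric.mem_closedBall, dist_zero_right, not_le, hx,
          Set.indicator_of_mem]
        rcases le_total 0 (p x) with h0 | h0
        · simp [h0]
        · rw [max_eq_left (by linarith)]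
          nlinarith
      · simp [h₀, hx]
    have hint : Integrable (fun x => -(p x * h₀ x)) := (hp.integrable_mul hmem).neg
    have hzero : ∫ x, -(p x * h₀ x) = 0 := by
      refine le_antisymm ?_ (integral_nonneg hneg)
      rw [integral_neg]
      linarith
    have := (integral_eq_zero_iff_of_nonneg hneg hint).1 hzero
    filter_upwards [this] with x hx hsx
    by_contra! h0
    have : h₀ x = -p x := by
      simp [h₀, hsx, h0.le]
    simp only [this, Pi.zero_apply] at hx
    nlinarith
  have hall : ∀ᵐ x : E d, ∀ m : ℕ, R + 1 / (m + 1) < ‖x‖ → 0 ≤ p x :=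
    ae_all_iff.2 fun m => key _ (by
      have : (0 : ℝ) < 1 / (m + 1) := Nat.one_div_pos_of_nat
      linarith)
  filter_upwards [hall] with x hx hRx
  obtain ⟨m, hm⟩ := exists_nat_one_div_lt (sub_pos.2 hRx)
  exact hx m (by linarith)

/-- The constant `1` is not an `L²` test function, and mass may escape to infinity. On a ball of
radius `s > R`, however, `f n` eventually has nonpositive mass, since it is nonnegative outside;
that local inequality passes to the limit. -/
theorem integral_nonpos (h : WeakTendsto volume f p) (hp : Integrable p) {r : ℕ → ℝ} {R : ℝ}
    (hr : Tendsto r atTop (𝓝 R)) (hf : ∀ n, IsSelfDual (r n) (f n)) : ∫ x, p x ≤ 0 := by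
  have hcov : AECover (volume : Measure (E d)) atTop (fun k : ℝ => Metric.closedBall (0 : E d) k) :=
    aecover_closedBall tendsto_id
  refine le_of_tendsto (hcov.integral_tendsto_of_countably_generated hp) ?_
  filter_upwards [eventually_gt_atTop R] with s hs
  refine le_of_tendsto (h.setIntegral Metric.isClosed_closedBall.measurableSet
    measure_closedBall_lt_top.ne) ?_
  filter_upwards [hr.eventually_lt_const hs] with n hn
  exact ((hf n).mono hn.le).setIntegral_closedBall_nonpos

/-- By the multiplication formula, self-duality says that pairing with `φ` equals pairing with `φ̂`
for each real test function `φ`. Both are in `L²`, so this is a weakly closed condition; `φ̂` is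
complex, hence the separate real and imaginary parts. -/
theorem hat_ae_eq (h : WeakTendsto volume f p) (hp : Integrable p)
    (hf : ∀ n, Integrable (f n)) (hf' : ∀ n, hat (f n) = fun x => (f n x : ℂ)) :
    hat p =ᵐ[volume] fun x => (p x : ℂ) := by
  have hflip : ∀ (u v : E d → ℂ), Integrable u → Integrable v →
      ∫ x, 𝓕 u x * v x = ∫ x, u x * 𝓕 v x := by
    intro u v hu hv
    have := VectorFourier.integral_fourierIntegral_smul_eq_flip (L := innerₗ (E d))
      Real.continuous_fourierChar (by exact continuous_inner) hu hv
    rw [flip_innerₗ] at this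
    exact this
  suffices hz : ∀ᵐ x, hat p x - (p x : ℂ) = 0 by
    filter_upwards [hz] with x hx using sub_eq_zero.1 hx
  have hloc : LocallyIntegrable (hat p) := (continuous_hat hp).locallyIntegrable
  refine ae_eq_zero_of_integral_contDiff_smul_eq_zero
    (hloc.sub hp.ofReal.locallyIntegrable) fun φ hφ hφc => ?_
  have hφC : ContDiff ℝ (⊤ : ℕ∞) (fun x => (φ x : ℂ)) := Complex.ofRealCLM.contDiff.comp hφ
  have hφCc : HasCompactSupport (fun x => (φ x : ℂ)) :=
    hφc.comp_left (g := ((↑) : ℝ → ℂ)) Complex.ofReal_zero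
  set S : SchwartzMap (E d) ℂ := hφCc.toSchwartzMap hφC
  have hS : ∀ x, S x = (φ x : ℂ) := fun x => rfl
  have hSφ : (S : E d → ℂ) = fun x => (φ x : ℂ) := funext hS
  set T : SchwartzMap (E d) ℂ := 𝓕 S
  have hT : (T : E d → ℂ) = 𝓕 (fun x => (φ x : ℂ)) := by
    rw [← hSφ]; exact SchwartzMap.fourier_coe S
  have hTm : MemLp T 2 := T.memLp 2
  have hφi : Integrable (fun x => (φ x : ℂ)) := by rw [← hSφ]; exact S.integrable
  have hbdd : ∀ x, ‖T x‖ ≤ ∫ t, ‖(φ t : ℂ)‖ := fun x => by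
    rw [hT]; exact VectorFourier.norm_fourierIntegral_le_integral_norm _ _ _ _ _
  have hintT : ∀ u : E d → ℝ, Integrable u → Integrable (fun x => (u x : ℂ) * T x) := fun u hu =>
    hu.ofReal.mul_bdd (c := ∫ t, ‖(φ t : ℂ)‖) T.continuous.aestronglyMeasurable
      (ae_of_all _ hbdd)
  have hsplit : ∀ u : E d → ℝ, Integrable u →
      ∫ x, (u x : ℂ) * T x =
        (∫ x, u x * (T x).re : ℝ) + (∫ x, u x * (T x).im : ℝ) * Complex.I := by
    intro u hu
    have := integral_re_add_im (hintT u hu)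
    simpa using this.symm
  have hdual : ∀ u : E d → ℝ, Integrable u → ∫ x, hat u x * φ x = ∫ x, (u x : ℂ) * T x := by
    intro u hu
    rw [hT]
    exact hflip _ _ hu.ofReal hφi
  have hfT : ∀ n, (∫ x, f n x * (T x).re = ∫ x, f n x * φ x) ∧ ∫ x, f n x * (T x).im = 0 := by
    intro n
    have h1 := (hdual (f n) (hf n)).symm
    rw [hsplit _ (hf n), hf' n] at h1
    have h2 : ∫ x, (f n x : ℂ) * (φ x : ℂ) = ((∫ x, f n x * φ x : ℝ) : ℂ) := by
      rw [← integral_complex_ofReal]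
      simp
    rw [h2] at h1
    constructor
    · simpa using congrArg Complex.re h1
    · simpa using congrArg Complex.im h1
  have hφ2 : MemLp φ 2 := by
    have : MemLp (fun x => (φ x : ℂ)) 2 := by rw [← hSφ]; exact S.memLp 2
    simpa using this.re
  have hre : ∫ x, p x * (T x).re = ∫ x, p x * φ x := by
    have h1 := h _ hTm.re
    simp only [RCLike.re_eq_complex_re, (hfT _).1] at h1
    exact tendsto_nhds_unique h1 (h φ hφ2)
  have him : ∫ x, p x * (T x).im = 0 := by
    have h1 := h _ hTm.im
    simp only [RCLike.im_eq_complex_im, (hfT _).2] at h1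
    exact tendsto_nhds_unique h1 tendsto_const_nhds
  have hfin : ∫ x, hat p x * φ x = ∫ x, (p x : ℂ) * φ x := by
    rw [hdual p hp, hsplit p hp, hre, him, ← integral_complex_ofReal]
    simp
  have hφb : ∀ x, ‖(φ x : ℂ)‖ ≤ SchwartzMap.seminorm ℝ 0 0 S := fun x => S.norm_le_seminorm ℝ x
  have hi1 : Integrable (fun x => hat p x * φ x) :=
    hφi.bdd_mul (c := ∫ t, ‖(p t : ℂ)‖) (continuous_hat hp).aestronglyMeasurable
      (ae_of_all _ fun x => VectorFourier.norm_fourierIntegral_le_integral_norm _ _ _ _ _)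
  have hi2 : Integrable (fun x => (p x : ℂ) * φ x) :=
    hp.ofReal.mul_bdd (c := SchwartzMap.seminorm ℝ 0 0 S) hφi.aestronglyMeasurable
      (ae_of_all _ hφb)
  calc ∫ x, φ x • (hat p x - (p x : ℂ)) = ∫ x, (hat p x * φ x - (p x : ℂ) * φ x) := by
        congr 1
        ext x
        rw [Complex.real_smul]
        ring
    _ = 0 := by rw [integral_sub hi1 hi2, hfin, sub_self]

end WeakTendsto

theorem exists_isSelfDual_weakTendsto {d : ℕ} {f : ℕ → E d → ℝ} {r : ℕ → ℝ} {R M : ℝ}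
    (hr : Tendsto r atTop (𝓝 R)) (hf : ∀ n, IsSelfDual (r n) (f n))
    (hM : ∀ n, ∫ x, |f n x| ≤ M) :
    ∃ g : E d → ℝ, IsSelfDual R g ∧ ∃ φ : ℕ → ℕ, StrictMono φ ∧ WeakTendsto volume (f ∘ φ) g := by
  obtain ⟨p, hpm, hp2, φ, hφ, hlim⟩ := exists_weakTendsto (fun n => (hf n).memLp_two) (C := M ^ 2)
    fun n => (hf n).integral_sq_le.trans
      (pow_le_pow_left₀ (integral_nonneg fun _ => abs_nonneg _) (hM n) 2)
  have hfφ : ∀ n, IsSelfDual ((r ∘ φ) n) ((f ∘ φ) n) := fun n => hf (φ n)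
  have hrφ : Tendsto (r ∘ φ) atTop (𝓝 R) := hr.comp hφ.tendsto_atTop
  have hp : Integrable p := hlim.integrable hpm hp2 (fun n => (hfφ n).integrable) fun n => hM (φ n)
  have hhat := hlim.hat_ae_eq hp (fun n => (hfφ n).integrable) fun n => (hfφ n).hat_eq
  -- The limit `p` is determined only almost everywhere; the real part of `p̂` is its continuous
  -- representative.
  set g : E d → ℝ := fun x => (hat p x).re
  have hgc : Continuous g := Complex.continuous_re.comp (continuous_hat hp)
  have hgp : g =ᵐ[volume] p := by
    filter_upwards [hhat] with x hx
    simp [g, hx]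
  have hghat : hat g = hat p := by
    ext x
    refine Real.fourier_congr_ae ?_ x
    filter_upwards [hgp] with x hx
    rw [hx]
  have hgeq : hat g = fun x => (g x : ℂ) := by
    refine (Continuous.ae_eq_iff_eq volume (hghat ▸ continuous_hat hp) (by fun_prop)).1 ?_
    filter_upwards [hhat, hgp] with x h1 h2
    rw [hghat, h1, h2]
  have hgi : Integrable g := hp.congr hgp.symm
  refine ⟨g, ⟨hgi, hgeq, ?_, ?_⟩, φ, hφ, fun h hh => ?_⟩
  · have h0 : ((g 0 : ℝ) : ℂ) = ((∫ x, g x : ℝ) : ℂ) := by rw [← hat_zero, hgeq]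
    rw [Complex.ofReal_injective h0, integral_congr_ae hgp]
    exact hlim.integral_nonpos hp hrφ hfφ
  · have hae := hlim.ae_nonneg hp2 hrφ hfφ
    have hopen : IsOpen {x : E d | R < ‖x‖ ∧ g x < 0} :=
      (isOpen_lt continuous_const continuous_norm).inter (isOpen_lt hgc continuous_const)
    have hnull : volume {x : E d | R < ‖x‖ ∧ g x < 0} = 0 := by
      refine measure_mono_null (fun x hx => ?_) (ae_iff.1 (hae.and hgp))
      simp only [Set.mem_ofPred_eq, not_and_or] at hx ⊢
      by_contra! hcon
      have := hcon.1 hx.1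
      rw [← hcon.2] at this
      linarith [hx.2]
    have hempty := hopen.measure_eq_zero_iff volume |>.1 hnull
    intro x hx
    by_contra! h0
    exact (Set.eq_empty_iff_forall_notMem.1 hempty x) ⟨hx, h0⟩
  · have hcong : ∫ x, g x * h x = ∫ x, p x * h x := by
      refine integral_congr_ae ?_
      filter_upwards [hgp] with x hx
      rw [hx]
    rw [hcong]
    exact hlim h hh

end RootUncertainty

/-! ### Nonvanishing of weak limits -/

namespace RootUncertainty

variable {d : ℕ}

/-- Normalised self-dual functions with bounded negativity radius cannot vanish in the weak
limit: otherwise their mass outside the ball would tend to zero, so that they would tend to zero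
pointwise and hence in `L¹`. -/
theorem not_weakTendsto_zero {f : ℕ → E d → ℝ} {R : ℝ} (hf : ∀ n, IsSelfDual R (f n))
    (h1 : ∀ n, ∫ x, |f n x| = 1) : ¬ WeakTendsto volume f 0 := by
  intro h
  set B : Set (E d) := Metric.closedBall 0 R
  have hB : MeasurableSet B := Metric.isClosed_closedBall.measurableSet
  have hBfin : volume B ≠ ∞ := measure_closedBall_lt_top.ne
  have hin : Tendsto (fun n => ∫ x in B, f n x) atTop (𝓝 0) := by
    simpa using h.setIntegral hB hBfin
  have hout : Tendsto (fun n => ∫ x in Bᶜ, f n x) atTop (𝓝 0) := by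
    refine squeeze_zero (fun n => (hf n).setIntegral_compl_nonneg) (fun n => ?_)
      (by simpa using hin.neg)
    linarith [(hf n).setIntegral_add_compl R]
  have hpt : ∀ x, Tendsto (fun n => f n x) atTop (𝓝 0) := by
    intro x
    set c : E d → ℝ := fun t => Real.cos (2 * Real.pi * inner ℝ t x)
    have hc : Continuous c := by fun_prop
    have hcb : ∀ t, ‖c t‖ ≤ 1 := fun t => Real.abs_cos_le_one _
    have hmem : MemLp (B.indicator c) 2 := by
      refine (memLp_indicator_const (E := ℝ) 2 hB 1 (Or.inr hBfin)).mono
        (hc.measurable.indicator hB).aestronglyMeasurable (ae_of_all _ fun t => ?_)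
      by_cases ht : t ∈ B
      · simpa [ht] using hcb t
      · simp [ht]
    have hA : Tendsto (fun n => ∫ t in B, f n t * c t) atTop (𝓝 0) := by
      have := h _ hmem
      simp only [Pi.zero_apply, zero_mul, integral_zero] at this
      refine this.congr fun n => ?_
      rw [← integral_indicator hB]
      congr 1
      ext t
      by_cases ht : t ∈ B <;> simp [ht]
    have hC : Tendsto (fun n => ∫ t in Bᶜ, f n t * c t) atTop (𝓝 0) := by
      refine squeeze_zero_norm (fun n => ?_) hout
      rw [← (hf n).setIntegral_compl_abs]
      refine norm_integral_le_of_norm_le (hf n).integrable.abs.integrableOn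
        (ae_of_all _ fun t => ?_)
      rw [norm_mul]
      exact mul_le_of_le_one_right (abs_nonneg _) (hcb t)
    have hsum := hA.add hC
    rw [add_zero] at hsum
    refine hsum.congr fun n => ?_
    rw [(hf n).eq_integral_cos x]
    exact integral_add_compl hB ((hf n).integrable.mul_bdd (c := 1) hc.aestronglyMeasurable
      (ae_of_all _ hcb))
  -- Dominated convergence on the ball: self-duality and unit `L¹` norm give `|f n| ≤ 1`.
  have hinabs : Tendsto (fun n => ∫ x in B, |f n x|) atTop (𝓝 0) := by
    have : IsFiniteMeasure (volume.restrict B) := ⟨by simpa using hBfin.lt_top⟩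
    have := tendsto_integral_of_dominated_convergence (μ := volume.restrict B)
      (F := fun n x => |f n x|) (f := fun _ => 0) (fun _ => 1)
      (fun n => (hf n).continuous.abs.aestronglyMeasurable) (integrable_const 1)
      (fun n => ae_of_all _ fun x => by
        rw [Real.norm_eq_abs, abs_abs, ← h1 n]
        exact (hf n).abs_le x)
      (ae_of_all _ fun x => by simpa using (hpt x).abs)
    simpa using this
  have htot := hinabs.add hout
  have : ∀ n, (∫ x in B, |f n x|) + ∫ x in Bᶜ, f n x = 1 := by
    intro n
    rw [← (hf n).setIntegral_compl_abs, integral_add_compl hB (hf n).integrable.abs, h1 n]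
  simp only [this, add_zero] at htot
  exact zero_ne_one (tendsto_nhds_unique htot tendsto_const_nhds)

end RootUncertainty

/-! ### Compact support of a function and its transform -/

namespace RootUncertainty

variable {d : ℕ}

/-- The Fourier transform of a compactly supported function extends to an entire function along
each line through the origin. -/
theorem differentiable_fourier_line {f : E d → ℂ} (hf : Integrable f) {r : ℝ}
    (hsupp : ∀ x, r < ‖x‖ → f x = 0) (y : E d) :
    Differentiable ℂ (fun z : ℂ =>
      ∫ x, Complex.exp ((-2 * Real.pi * inner ℝ x y : ℝ) * Complex.I * z) * f x) := by
  intro z₀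
  set a : E d → ℂ := fun x => ((-2 * Real.pi * inner ℝ x y : ℝ) : ℂ) * Complex.I
  have hac : Continuous a := by fun_prop
  set K : ℝ := 2 * Real.pi * (|r| * ‖y‖)
  have hK : 0 ≤ K := by positivity
  have ha : ∀ x, ‖x‖ ≤ r → ‖a x‖ ≤ K := by
    intro x hx
    have h1 := abs_real_inner_le_norm x y
    have h2 : ‖x‖ * ‖y‖ ≤ |r| * ‖y‖ :=
      mul_le_mul_of_nonneg_right (hx.trans (le_abs_self r)) (norm_nonneg _)
    simp only [a, norm_mul, Complex.norm_real, Complex.norm_I, mul_one, norm_neg,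
      Real.norm_eq_abs, abs_two, abs_of_pos Real.pi_pos, K]
    exact mul_le_mul_of_nonneg_left (h1.trans h2) (by positivity)
  set bound : E d → ℝ := fun x => K * Real.exp (K * (‖z₀‖ + 1)) * ‖f x‖
  have hexp : ∀ x, ‖x‖ ≤ r → ∀ z ∈ Metric.ball z₀ 1,
      ‖Complex.exp (a x * z)‖ ≤ Real.exp (K * (‖z₀‖ + 1)) := by
    intro x hx z hz
    refine (Complex.norm_exp_le_exp_norm _).trans (Real.exp_le_exp.2 ?_)
    rw [norm_mul]
    have : ‖z‖ ≤ ‖z₀‖ + 1 := by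
      have h1 := norm_sub_norm_le z z₀
      rw [Metric.mem_ball, dist_eq_norm] at hz
      linarith
    exact mul_le_mul (ha x hx) this (norm_nonneg _) hK
  have hmeas : ∀ z, AEStronglyMeasurable (fun x => Complex.exp (a x * z) * f x) volume := fun z =>
    (Continuous.aestronglyMeasurable (by fun_prop)).mul hf.aestronglyMeasurable
  have hz₀ : z₀ ∈ Metric.ball z₀ 1 := Metric.mem_ball_self one_pos
  have := hasDerivAt_integral_of_dominated_loc_of_deriv_le (μ := volume) (x₀ := z₀)
    (s := Metric.ball z₀ 1)
    (F := fun z x => Complex.exp (a x * z) * f x)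
    (F' := fun z x => Complex.exp (a x * z) * a x * f x) (bound := bound)
    (Metric.ball_mem_nhds _ one_pos) (Eventually.of_forall hmeas) ?_ ?_ ?_ ?_ ?_
  · exact this.2.differentiableAt
  · refine (hf.norm.const_mul (Real.exp (K * (‖z₀‖ + 1)))).mono' (hmeas z₀)
      (ae_of_all _ fun x => ?_)
    rcases le_or_gt ‖x‖ r with hx | hx
    · rw [norm_mul]
      exact mul_le_mul_of_nonneg_right (hexp x hx z₀ hz₀) (norm_nonneg _)
    · simp [hsupp x hx]
  · exact (Continuous.aestronglyMeasurable (by fun_prop)).mul hf.aestronglyMeasurable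
  · refine ae_of_all _ fun x z hz => ?_
    rcases le_or_gt ‖x‖ r with hx | hx
    · rw [norm_mul, norm_mul, mul_comm ‖Complex.exp _‖]
      exact mul_le_mul_of_nonneg_right
        (mul_le_mul (ha x hx) (hexp x hx z hz) (norm_nonneg _) hK) (norm_nonneg _)
    · simp [hsupp x hx, bound]
  · exact hf.norm.const_mul _
  · refine ae_of_all _ fun x z _ => ?_
    have h1 : HasDerivAt (fun z => a x * z) (a x) z := by
      simpa using (hasDerivAt_id z).const_mul (a x)
    exact h1.cexp.mul_const (f x)

theorem eq_zero_of_hat_eq_zero {f : E d → ℝ} (hfc : Continuous f) (hf : Integrable f)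
    (hhat : hat f = 0) : f = 0 := by
  have hinv := (Complex.continuous_ofReal.comp hfc).fourierInv_fourier_eq hf.ofReal
    (by change Integrable (hat f); rw [hhat]; exact integrable_zero _ _ _)
  ext x
  have h1 := congrFun hinv x
  have h2 : 𝓕 (Complex.ofReal ∘ f) = 0 := hhat
  rw [h2, Real.fourierInv_eq] at h1
  simp only [Pi.zero_apply, smul_zero, integral_zero, Function.comp_apply] at h1
  exact_mod_cast h1.symm

/-- A function and its Fourier transform cannot both be compactly supported. -/
theorem eq_zero_of_compact_support [Nontrivial (E d)] {f : E d → ℝ} (hfc : Continuous f)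
    (hf : Integrable f)
    {r : ℝ} (hsupp : ∀ x, r < ‖x‖ → f x = 0) (hsupp' : ∀ x, r < ‖x‖ → hat f x = 0) : f = 0 := by
  have hline : ∀ y : E d, y ≠ 0 → ∀ t : ℝ, hat f (t • y) = 0 := by
    intro y hy
    set F : ℂ → ℂ := fun z =>
      ∫ x, Complex.exp ((-2 * Real.pi * inner ℝ x y : ℝ) * Complex.I * z) * (f x : ℂ)
    have hF : Differentiable ℂ F :=
      differentiable_fourier_line hf.ofReal (r := r) (fun x hx => by simp [hsupp x hx]) y
    have hFt : ∀ t : ℝ, F t = hat f (t • y) := by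
      intro t
      rw [hat_apply]
      refine integral_congr_ae (ae_of_all _ fun x => ?_)
      simp only
      congr 2
      rw [inner_smul_right]
      push_cast
      ring
    have hpos : 0 < ‖y‖ := norm_pos_iff.2 hy
    have hlarge : ∀ t : ℝ, |r| / ‖y‖ < t → F t = 0 := by
      intro t ht
      rw [hFt]
      apply hsupp'
      rw [norm_smul]
      have := (div_lt_iff₀ hpos).1 ht
      calc r ≤ |r| := le_abs_self r
        _ < t * ‖y‖ := this
        _ ≤ ‖t‖ * ‖y‖ := mul_le_mul_of_nonneg_right (le_abs_self t) hpos.le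
    -- The entire function `F` vanishes at all real points near `T`, so its zeros accumulate there.
    set T : ℝ := |r| / ‖y‖ + 1
    have htend : Tendsto (fun t : ℝ => (t : ℂ)) (𝓝[≠] T) (𝓝[≠] (T : ℂ)) := by
      refine tendsto_nhdsWithin_iff.2 ⟨(Complex.continuous_ofReal.tendsto T).mono_left
        nhdsWithin_le_nhds, ?_⟩
      filter_upwards [self_mem_nhdsWithin] with t ht
      simpa using ht
    have hev : ∀ᶠ t : ℝ in 𝓝[≠] T, F t = 0 := by
      filter_upwards [nhdsWithin_le_nhds (lt_mem_nhds (lt_add_one (|r| / ‖y‖)))] with t ht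
      exact hlarge t ht
    have hzero : Set.EqOn F 0 Set.univ :=
      AnalyticOnNhd.eqOn_zero_of_preconnected_of_frequently_eq_zero
        (fun z _ => hF.analyticAt z) isPreconnected_univ (Set.mem_univ (T : ℂ))
        (htend.frequently hev.frequently)
    intro t
    rw [← hFt]
    exact hzero (Set.mem_univ _)
  have hhat : hat f = 0 := by
    ext y
    obtain rfl | hy := eq_or_ne y 0
    · obtain ⟨v, hv⟩ := exists_ne (0 : E d)
      simpa using hline v hv 0
    · simpa using hline y hy 1
  exact eq_zero_of_hat_eq_zero hfc hf hhat

end RootUncertainty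

/-! ### Reduction to self-dual functions -/

namespace RootUncertainty

variable {d : ℕ}

theorem hat_neg (f : E d → ℝ) (hf : Integrable f) (y : E d) :
    hat f (-y) = (starRingEnd ℂ) (hat f y) := by
  apply Complex.ext
  · rw [Complex.conj_re, hat_re hf, hat_re hf]
    simp
  · rw [Complex.conj_im, hat_im hf, hat_im hf, ← integral_neg]
    simp

/-- The sum of `f`, its reflection, and the real part of their Fourier transforms. -/
noncomputable def symmetrize (f : E d → ℝ) : E d → ℝ := fun x => f x + f (-x) + 2 * (hat f x).re

/-- For real `f`, `2 Re f̂(x) = f̂(x) + f̂(-x)`. By Fourier inversion the transform exchanges this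
with `f(x) + f(-x)`. -/
theorem isSelfDual_symmetrize {f : E d → ℝ} (hfc : Continuous f) (hf : Integrable f)
    (hfh : Integrable (hat f)) {r : ℝ} (h0 : f 0 ≤ 0) (hh0 : (hat f 0).re ≤ 0)
    (hr : ∀ x, r < ‖x‖ → 0 ≤ f x) (hr' : ∀ x, r < ‖x‖ → 0 ≤ (hat f x).re) :
    IsSelfDual r (symmetrize f) := by
  have hinv : ∀ y, 𝓕 (hat f) (-y) = f y := by
    intro y
    rw [← Real.fourierInv_eq_fourier_neg]
    exact congrFun ((Complex.continuous_ofReal.comp hfc).fourierInv_fourier_eq hf.ofReal hfh) y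
  have hneg : Integrable (fun x => f (-x)) := hf.comp_neg
  have hre : Integrable (fun x => (hat f x).re) := hfh.re
  have hsym : ∀ y, ((2 * (hat f y).re : ℝ) : ℂ) = hat f y + hat f (-y) := by
    intro y
    rw [hat_neg f hf, Complex.add_conj]
  have hhat3 : hat (fun x => 2 * (hat f x).re) = fun y => ((f y + f (-y) : ℝ) : ℂ) := by
    have h1 : (fun x => ((2 * (hat f x).re : ℝ) : ℂ)) = hat f + fun x => hat f (-x) :=
      funext hsym
    ext y
    rw [hat, h1]
    have h2 := congrFun (VectorFourier.fourierIntegral_add (L := innerₗ (E d))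
      Real.continuous_fourierChar (by exact continuous_inner) hfh (𝕜 := ℝ) (E := ℂ)
      hfh.comp_neg) y
    refine h2.trans ?_
    have h3 : 𝓕 (fun x => hat f (-x)) y = 𝓕 (hat f) (-y) :=
      Real.fourier_comp_linearIsometry (LinearIsometryEquiv.neg ℝ) (hat f) y
    have h4 : 𝓕 (hat f) y = f (-y) := by simpa using hinv (-y)
    change 𝓕 (hat f) y + 𝓕 (fun x => hat f (-x)) y = _
    rw [h3, h4, hinv]
    push_cast
    ring
  refine ⟨(hf.add hneg).add (hre.const_mul 2), ?_, ?_, fun x hx => ?_⟩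
  · have h1 : symmetrize f = (f + fun x => f (-x)) + fun x => 2 * (hat f x).re := rfl
    rw [h1, hat_add (hf.add hneg) (hre.const_mul 2), hat_add hf hneg, hhat3]
    ext y
    have h2 : hat (fun x => f (-x)) y = hat f (-y) :=
      hat_comp_isometry (LinearIsometryEquiv.neg ℝ) f y
    simp only [Pi.add_apply]
    rw [h2, ← hsym]
    push_cast
    ring
  · simp only [symmetrize, neg_zero]
    linarith
  · have h1 := hr x hx
    have h2 := hr (-x) (by rwa [norm_neg])
    have h3 := hr' x hx
    simp only [symmetrize]
    linarith

/-- Outside the ball all the summands are nonnegative, so a zero sum makes each of them vanish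
there. -/
theorem symmetrize_ne_zero [Nontrivial (E d)] {f : E d → ℝ} (hfc : Continuous f)
    (hf : Integrable f) (hf0 : f ≠ 0) {r : ℝ}
    (hr : ∀ x, r < ‖x‖ → 0 ≤ f x)
    (hr' : ∀ x, r < ‖x‖ → 0 ≤ (hat f x).re ∧ (hat f x).im = 0) :
    symmetrize f ≠ 0 := by
  intro h
  have key : ∀ x, r < ‖x‖ → f x = 0 ∧ hat f x = 0 := by
    intro x hx
    have h1 := hr x hx
    have h2 := hr (-x) (by rwa [norm_neg])
    have h3 := hr' x hx
    have h4 : f x + f (-x) + 2 * (hat f x).re = 0 := congrFun h x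
    exact ⟨by linarith, Complex.ext (by simp; linarith) h3.2⟩
  exact hf0 (eq_zero_of_compact_support hfc hf (fun x hx => (key x hx).1) fun x hx => (key x hx).2)

theorem hat_comp_smul (f : E d → ℝ) {c : ℝ} (hc : 0 < c) (y : E d) :
    hat (fun x => f (c • x)) y = ((c ^ d)⁻¹ : ℝ) * hat f (c⁻¹ • y) := by
  rw [hat_apply, hat_apply]
  have h := Measure.integral_comp_smul (volume : Measure (E d))
    (fun u => Complex.exp (↑(-2 * Real.pi * inner ℝ u (c⁻¹ • y)) * Complex.I) * (f u : ℂ)) c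
  rw [finrank_euclideanSpace_fin, abs_of_pos (by positivity), Complex.real_smul] at h
  rw [← h]
  refine integral_congr_ae (ae_of_all _ fun x => ?_)
  simp only [inner_smul_left, inner_smul_right]
  congr 5
  simp only [conj_trivial]
  exact (inv_mul_cancel_left₀ hc.ne' _).symm

/-- Rescaling an admissible function equalises the two radii, and symmetrizing it makes it
self-dual. -/
theorem IsAdmissible.exists_isSelfDual [Nontrivial (E d)] {f : E d → ℝ} (hf : IsAdmissible f)
    {r s : ℝ} (hr : 0 < r) (hs : 0 < s) (hfr : ∀ x, r < ‖x‖ → 0 ≤ f x)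
    (hfs : ∀ x, s < ‖x‖ → 0 ≤ (hat f x).re ∧ (hat f x).im = 0) :
    ∃ g : E d → ℝ, g ≠ 0 ∧ IsSelfDual (√r * √s) g := by
  -- The dilation factor solves `r / c = s c`, and the common value is `√r √s`.
  set c : ℝ := √r / √s
  have hr' : 0 < √r := Real.sqrt_pos.2 hr
  have hs' : 0 < √s := Real.sqrt_pos.2 hs
  have hc : 0 < c := div_pos hr' hs'
  set u : E d → ℝ := fun x => f (c • x)
  have hû : ∀ y, hat u y = ((c ^ d)⁻¹ : ℝ) * hat f (c⁻¹ • y) := hat_comp_smul f hc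
  have huc : Continuous u := hf.continuous.comp (continuous_const_smul c)
  have hui : Integrable u := hf.integrable.comp_smul hc.ne'
  have huh : Integrable (hat u) := by
    rw [funext hû]
    exact (hf.integrable_hat.comp_smul (inv_ne_zero hc.ne')).const_mul _
  have hu0 : u ≠ 0 := by
    intro h
    apply hf.ne_zero
    ext x
    simpa [u, smul_smul, mul_inv_cancel₀ hc.ne'] using congrFun h (c⁻¹ • x)
  have hcd : 0 < (c ^ d)⁻¹ := by positivity
  have hur : ∀ x, √r * √s < ‖x‖ → 0 ≤ u x := by
    intro x hx
    apply hfr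
    rw [norm_smul, Real.norm_eq_abs, abs_of_pos hc]
    calc r = c * (√r * √s) := by
          simp only [c]; field_simp; exact (Real.sq_sqrt hr.le).symm
      _ < c * ‖x‖ := mul_lt_mul_of_pos_left hx hc
  have hus : ∀ x, √r * √s < ‖x‖ → 0 ≤ (hat u x).re ∧ (hat u x).im = 0 := by
    intro x hx
    have := hfs (c⁻¹ • x) (by
      rw [norm_smul, Real.norm_eq_abs, abs_of_pos (inv_pos.2 hc)]
      calc s = c⁻¹ * (√r * √s) := by
            simp only [c]; field_simp; exact (Real.sq_sqrt hs.le).symm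
        _ < c⁻¹ * ‖x‖ := mul_lt_mul_of_pos_left hx (inv_pos.2 hc))
    rw [hû, Complex.re_ofReal_mul, Complex.im_ofReal_mul, this.2, mul_zero]
    exact ⟨mul_nonneg hcd.le this.1, rfl⟩
  refine ⟨symmetrize u, symmetrize_ne_zero huc hui hu0 hur hus,
    isSelfDual_symmetrize huc hui huh ?_ ?_ hur fun x hx => (hus x hx).1⟩
  · simpa [u] using hf.apply_zero_nonpos
  · rw [hû, Complex.re_ofReal_mul, smul_zero]
    exact mul_nonpos_of_nonneg_of_nonpos hcd.le hf.hat_zero_nonpos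

/-! ### Gaussians and a self-dual example -/

/-- The Gaussian `exp (-π a |x|²)`. -/
noncomputable def gaussian (a : ℝ) : E d → ℝ := fun x => Real.exp (-(Real.pi * a) * ‖x‖ ^ 2)

theorem gaussian_pos (a : ℝ) (x : E d) : 0 < gaussian a x := Real.exp_pos _

theorem continuous_gaussian (a : ℝ) : Continuous (gaussian a : E d → ℝ) := by
  unfold gaussian
  fun_prop

theorem gaussian_zero (a : ℝ) : gaussian a (0 : E d) = 1 := by simp [gaussian]

theorem integrable_gaussian {a : ℝ} (ha : 0 < a) : Integrable (gaussian a : E d → ℝ) := by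
  have h := (GaussianFourier.integrable_cexp_neg_mul_sq_norm_add (V := E d)
    (b := ((Real.pi * a : ℝ) : ℂ)) (by simpa using mul_pos Real.pi_pos ha) 0 0).re
  refine h.congr (ae_of_all _ fun x => ?_)
  simp only [gaussian, zero_mul, add_zero, RCLike.re_eq_complex_re]
  rw [← Complex.ofReal_re (Real.exp _)]
  push_cast
  rfl

theorem hat_gaussian {a : ℝ} (ha : 0 < a) (y : E d) :
    hat (gaussian a) y = (((a⁻¹) ^ ((d : ℝ) / 2) * gaussian a⁻¹ y : ℝ) : ℂ) := by
  have h := fourier_gaussian_innerProductSpace (V := E d)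
    (b := ((Real.pi * a : ℝ) : ℂ)) (by simpa using mul_pos Real.pi_pos ha) y
  have h1 : (fun x : E d => (gaussian a x : ℂ)) =
      fun v => Complex.exp (-((Real.pi * a : ℝ) : ℂ) * (‖v‖ : ℂ) ^ 2) := by
    ext x
    simp [gaussian]
  rw [hat, h1, h, finrank_euclideanSpace_fin]
  have hπ : (Real.pi : ℂ) ≠ 0 := by exact_mod_cast Real.pi_ne_zero
  have haC : (a : ℂ) ≠ 0 := by exact_mod_cast ha.ne'
  have h2 : (Real.pi : ℂ) / ((Real.pi * a : ℝ) : ℂ) = ((a⁻¹ : ℝ) : ℂ) := by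
    push_cast
    field_simp
  rw [h2, Complex.ofReal_mul (_ ^ _), Complex.ofReal_cpow (inv_pos.2 ha).le, gaussian, Complex.ofReal_exp]
  congr 2
  · push_cast; rfl
  · push_cast
    field_simp

theorem hat_gaussian_one (y : E d) : hat (gaussian 1) y = (gaussian 1 y : ℂ) := by
  rw [hat_gaussian one_pos]
  simp

/-- With `c = 2^(d/2)`, the transform exchanges `gaussian 2⁻¹` and `c * gaussian 2`. Subtracting `(1
+ c) * gaussian 1` cancels the value at the origin, and the widest Gaussian dominates far out. -/
theorem exists_isSelfDual [Nontrivial (E d)] :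
    ∃ r : ℝ, ∃ f : E d → ℝ, f ≠ 0 ∧ IsSelfDual r f := by
  set c : ℝ := 2 ^ ((d : ℝ) / 2)
  have hc : 0 < c := by positivity
  have hcc : c * (2⁻¹) ^ ((d : ℝ) / 2) = 1 := by
    rw [Real.inv_rpow zero_le_two]
    exact mul_inv_cancel₀ hc.ne'
  set f : E d → ℝ := (gaussian 2⁻¹ + fun x => c * gaussian 2 x) + fun x => -(1 + c) * gaussian 1 x
  have hi1 : Integrable (gaussian 2⁻¹ : E d → ℝ) := integrable_gaussian (by norm_num)
  have hi2 : Integrable (fun x : E d => c * gaussian 2 x) :=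
    (integrable_gaussian two_pos).const_mul c
  have hi3 : Integrable (fun x : E d => -(1 + c) * gaussian 1 x) :=
    (integrable_gaussian one_pos).const_mul _
  have hpos : ∀ x : E d, c + 1 < ‖x‖ → 0 < f x := by
    intro x hx
    have h1 : 1 + c ≤ Real.exp (Real.pi / 2 * ‖x‖ ^ 2) := by
      refine le_trans ?_ (Real.add_one_le_exp _)
      have : 3 / 2 * ‖x‖ ^ 2 ≤ Real.pi / 2 * ‖x‖ ^ 2 :=
        mul_le_mul_of_nonneg_right (by linarith [Real.pi_gt_three]) (sq_nonneg _)
      nlinarith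
    have h2 : Real.exp (Real.pi / 2 * ‖x‖ ^ 2) * gaussian 1 x = gaussian 2⁻¹ x := by
      simp only [gaussian, ← Real.exp_add]
      congr 1
      ring
    have h3 := mul_le_mul_of_nonneg_right h1 (gaussian_pos 1 x).le
    rw [h2] at h3
    have h4 := mul_pos hc (gaussian_pos 2 x)
    simp only [f, Pi.add_apply]
    linarith
  refine ⟨c + 1, f, ?_, (hi1.add hi2).add hi3, ?_, ?_, fun x hx => (hpos x hx).le⟩
  · obtain ⟨x, hx⟩ := NormedSpace.exists_lt_norm ℝ (E d) (c + 1)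
    exact fun h => (hpos x hx).ne' (congrFun h x)
  · ext y
    simp only [f]
    rw [hat_add (hi1.add hi2) hi3, hat_add hi1 hi2]
    simp only [Pi.add_apply]
    rw [hat_const_mul, hat_const_mul, hat_gaussian_one, hat_gaussian (by norm_num),
      hat_gaussian two_pos, inv_inv, ← Complex.ofReal_mul, ← mul_assoc, hcc, one_mul,
      ← Complex.ofReal_mul]
    push_cast
    ring
  · simp only [f, Pi.add_apply, gaussian_zero]
    linarith

end RootUncertainty

/-! ### Existence, symmetry and vanishing at the origin -/

namespace RootUncertainty

variable {d : ℕ}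

namespace IsSelfDual

variable {r : ℝ} {f g : E d → ℝ}

theorem integral_abs_pos (hf : IsSelfDual r f) (h0 : f ≠ 0) : 0 < ∫ x, |f x| := by
  refine (integral_nonneg fun _ => abs_nonneg _).lt_of_ne fun h => h0 ?_
  ext x
  have := hf.abs_le x
  rw [← h] at this
  exact abs_nonpos_iff.1 this

/-- A nonzero self-dual function is negative somewhere away from the origin. -/
theorem radius_pos (hf : IsSelfDual r f) [Nontrivial (E d)] (h0 : f ≠ 0) : 0 < r := by
  by_contra! hr
  have hae : 0 ≤ᵐ[volume] f := by
    filter_upwards [(measure_eq_zero_iff_ae_notMem (μ := volume) (s := {(0 : E d)})).1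
      (measure_singleton 0)] with x hx
    exact hf.nonneg x (hr.trans_lt (norm_pos_iff.2 hx))
  have h1 : ∫ x, f x = 0 := le_antisymm hf.integral_nonpos (integral_nonneg_of_ae hae)
  have h2 := (integral_eq_zero_iff_of_nonneg_ae hae hf.integrable).1 h1
  exact h0 ((Continuous.ae_eq_iff_eq volume hf.continuous continuous_const).1 h2)

/-- Zero mass on the ball would force zero mass outside, hence compact support of `f = f̂`. Strict
negativity permits the normalisation to mass `-1`. -/
theorem setIntegral_closedBall_neg [Nontrivial (E d)] (hf : IsSelfDual r f) (h0 : f ≠ 0) :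
    ∫ x in Metric.closedBall 0 r, f x < 0 := by
  refine hf.setIntegral_closedBall_nonpos.lt_of_ne fun h => h0 ?_
  have h1 : ∫ x in (Metric.closedBall 0 r)ᶜ, |f x| = 0 := by
    rw [hf.setIntegral_compl_abs]
    linarith [hf.setIntegral_add_compl r, hf.setIntegral_compl_nonneg]
  have h2 := (integral_eq_zero_iff_of_nonneg (fun _ => abs_nonneg _)
    hf.integrable.abs.integrableOn).1 h1
  have hopen : IsOpen (Metric.closedBall (0 : E d) r)ᶜ := Metric.isClosed_closedBall.isOpen_compl
  have h3 := Measure.eqOn_open_of_ae_eq h2 hopen hf.continuous.abs.continuousOn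
    continuousOn_const
  have h4 : ∀ x, r < ‖x‖ → f x = 0 := fun x hx => by
    simpa using h3 (show x ∈ (Metric.closedBall (0 : E d) r)ᶜ by simpa using hx)
  exact eq_zero_of_compact_support hf.continuous hf.integrable h4
    fun x hx => by simp [hf.hat_eq, h4 x hx]

end IsSelfDual

/-- The least radius of a nonzero self-dual function is attained. -/
theorem exists_isSelfDual_minimal [Nontrivial (E d)] :
    ∃ a : ℝ, 0 < a ∧ (∃ f : E d → ℝ, f ≠ 0 ∧ IsSelfDual a f) ∧
      ∀ (s : ℝ) (g : E d → ℝ), g ≠ 0 → IsSelfDual s g → a ≤ s := by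
  set S : Set ℝ := {r | ∃ f : E d → ℝ, f ≠ 0 ∧ IsSelfDual r f}
  have hne : S.Nonempty := exists_isSelfDual
  have hbdd : BddBelow S := ⟨0, fun r ⟨f, h0, hf⟩ => (hf.radius_pos h0).le⟩
  obtain ⟨u, hu, hulim, huS⟩ := exists_seq_tendsto_sInf hne hbdd
  choose v hv0 hv using huS
  set w : ℕ → E d → ℝ := fun n x => (∫ t, |v n t|)⁻¹ * v n x
  have hw : ∀ n, IsSelfDual (u n) (w n) := fun n =>
    (hv n).const_mul (inv_pos.2 ((hv n).integral_abs_pos (hv0 n))).le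
  have hw1 : ∀ n, ∫ x, |w n x| = 1 := by
    intro n
    have hpos := (hv n).integral_abs_pos (hv0 n)
    simp only [w, abs_mul, abs_of_pos (inv_pos.2 hpos)]
    rw [integral_const_mul, inv_mul_cancel₀ hpos.ne']
  obtain ⟨f, hf, φ, hφ, hlim⟩ := exists_isSelfDual_weakTendsto hulim hw fun n => (hw1 n).le
  have hf0 : f ≠ 0 := by
    rintro rfl
    -- The minimising radii decrease, so `u 0` bounds them all.
    refine not_weakTendsto_zero (R := u 0) (fun n => (hw (φ n)).mono (hu (Nat.zero_le _)))
      (fun n => hw1 (φ n)) hlim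
  exact ⟨sInf S, hf.radius_pos hf0, ⟨f, hf0, hf⟩, fun s g hg0 hg => csInf_le hbdd ⟨g, hg0, hg⟩⟩

/-- Among the self-dual functions of a given radius with mass `-1` on the ball, the one of
least `L²` norm exists, is unique, and is therefore radial. -/
theorem exists_isSelfDual_isRadial [Nontrivial (E d)] {a : ℝ} {f : E d → ℝ} (hf0 : f ≠ 0)
    (hf : IsSelfDual a f) : ∃ g : E d → ℝ, g ≠ 0 ∧ IsSelfDual a g ∧ IsRadial g := by
  set B : Set (E d) := Metric.closedBall 0 a
  have hB : MeasurableSet B := Metric.isClosed_closedBall.measurableSet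
  have hBfin : volume B ≠ ∞ := measure_closedBall_lt_top.ne
  set K : Set (E d → ℝ) := {g | IsSelfDual a g ∧ ∫ x in B, g x = -1}
  set N : (E d → ℝ) → ℝ := fun g => ∫ x, g x ^ 2
  have hKne : (N '' K).Nonempty := by
    have hneg := hf.setIntegral_closedBall_neg hf0
    refine ⟨_, _, ⟨hf.const_mul (c := (-∫ x in B, f x)⁻¹) (inv_pos.2 (by linarith)).le, ?_⟩, rfl⟩
    rw [integral_const_mul, inv_neg, neg_mul, inv_mul_cancel₀ hneg.ne]
  have hbdd : BddBelow (N '' K) := by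
    refine ⟨0, ?_⟩
    rintro _ ⟨g, -, rfl⟩
    exact integral_nonneg fun _ => sq_nonneg _
  set m := sInf (N '' K)
  have hm : ∀ g ∈ K, m ≤ N g := fun g hg => csInf_le hbdd ⟨g, hg, rfl⟩
  obtain ⟨u, hu, hulim, huK⟩ := exists_seq_tendsto_sInf hKne hbdd
  choose v hvK hvu using huK
  -- On the ball `|v| ≤ 1 + v²`; outside, the mass is at most `1` because the total integral is
  -- nonpositive.
  have hL1 : ∀ n, ∫ x, |v n x| ≤ volume.real B + u 0 + 1 := by
    intro n
    obtain ⟨hv, hvB⟩ := hvK n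
    have : IsFiniteMeasure (volume.restrict B) := ⟨by simpa using hBfin.lt_top⟩
    have h1 : ∫ x in B, |v n x| ≤ ∫ x in B, (1 + v n x ^ 2) := by
      refine integral_mono hv.integrable.abs.integrableOn
        ((integrable_const 1).add hv.integrable_sq.integrableOn) fun x => ?_
      have := sq_nonneg (|v n x| - 1)
      have h2 := sq_abs (v n x)
      simp only
      nlinarith [abs_nonneg (v n x)]
    have h2 : ∫ x in B, (1 + v n x ^ 2) = volume.real B + ∫ x in B, v n x ^ 2 := by
      rw [integral_add (integrable_const 1) hv.integrable_sq.integrableOn]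
      simp
    have h3 : ∫ x in B, v n x ^ 2 ≤ u 0 :=
      (setIntegral_le_integral hv.integrable_sq (ae_of_all _ fun x => sq_nonneg _)).trans
        ((hvu n).trans_le (hu (Nat.zero_le n)))
    have h4 : ∫ x in Bᶜ, |v n x| ≤ 1 := by
      rw [hv.setIntegral_compl_abs]
      linarith [hv.setIntegral_add_compl a]
    rw [← integral_add_compl hB hv.integrable.abs]
    linarith
  obtain ⟨g, hg, φ, hφ, hlim⟩ :=
    exists_isSelfDual_weakTendsto tendsto_const_nhds (fun n => (hvK n).1) hL1
  have hgB : ∫ x in B, g x = -1 := by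
    have h1 := hlim.setIntegral hB hBfin
    simp only [Function.comp_apply, (hvK _).2] at h1
    exact tendsto_nhds_unique h1 tendsto_const_nhds
  have hgK : g ∈ K := ⟨hg, hgB⟩
  -- Weak lower semicontinuity: integrate `v g ≤ (v² + g²) / 2` and let `v` tend weakly to `g`.
  have hgm : N g ≤ m := by
    have h1 := hlim g hg.memLp_two
    have h2 : Tendsto (fun n => (u (φ n) + N g) / 2) atTop (𝓝 ((m + N g) / 2)) :=
      ((hulim.comp hφ.tendsto_atTop).add_const _).div_const 2
    have h3 := le_of_tendsto_of_tendsto' h1 h2 fun n => by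
      rw [← hvu (φ n), ← integral_add (hvK _).1.integrable_sq hg.integrable_sq,
        ← integral_div]
      refine integral_mono ((hvK _).1.memLp_two.integrable_mul hg.memLp_two)
        (((hvK _).1.integrable_sq.add hg.integrable_sq).div_const 2) fun x => ?_
      have := sq_nonneg (v (φ n) x - g x)
      simp only [Function.comp_apply]
      linarith
    have h4 : ∫ x, g x * g x = N g := by simp only [N, sq]
    rw [h4] at h3
    linarith
  -- The midpoint of `h` and `g` stays in `K`, so the parallelogram identity forces `∫ (h - g)² =
  -- 0`.
  have huniq : ∀ h ∈ K, N h ≤ m → h = g := by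
    intro h hhK hhm
    have hmid : (fun x => 2⁻¹ * (h + g) x) ∈ K := by
      refine ⟨(hhK.1.add hg).const_mul (by norm_num), ?_⟩
      rw [integral_const_mul]
      simp only [Pi.add_apply]
      rw [integral_add hhK.1.integrable.integrableOn hg.integrable.integrableOn, hhK.2, hgB]
      norm_num
    have hcross : Integrable (fun x => h x * g x) := hhK.1.memLp_two.integrable_mul hg.memLp_two
    have hadd : Integrable (fun x => h x ^ 2 + g x ^ 2) :=
      hhK.1.integrable_sq.add hg.integrable_sq
    have h1 : N (fun x => 2⁻¹ * (h + g) x) = (N h + N g + 2 * ∫ x, h x * g x) / 4 := by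
      simp only [N]
      rw [← integral_const_mul, ← integral_add hhK.1.integrable_sq hg.integrable_sq,
        ← integral_add hadd (hcross.const_mul 2),
        ← integral_div]
      congr 1
      ext x
      simp only [Pi.add_apply]
      ring
    have h2 : ∫ x, (h x - g x) ^ 2 = N h + N g - 2 * ∫ x, h x * g x := by
      simp only [N]
      rw [← integral_const_mul, ← integral_add hhK.1.integrable_sq hg.integrable_sq,
        ← integral_sub hadd (hcross.const_mul 2)]
      congr 1
      ext x
      ring
    have h3 := hm _ hmid
    have h4 : ∫ x, (h x - g x) ^ 2 = 0 :=
      le_antisymm (by linarith) (integral_nonneg fun _ => sq_nonneg _)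
    have hint : Integrable (fun x => (h x - g x) ^ 2) := by
      refine (hadd.sub (hcross.const_mul 2)).congr
        (ae_of_all _ fun x => ?_)
      simp only [Pi.sub_apply]
      ring
    have h5 := (integral_eq_zero_iff_of_nonneg (fun _ => sq_nonneg _) hint).1 h4
    refine (Continuous.ae_eq_iff_eq volume hhK.1.continuous hg.continuous).1 ?_
    filter_upwards [h5] with x hx
    exact sub_eq_zero.1 (pow_eq_zero_iff two_ne_zero |>.1 hx)
  have hinv : ∀ L : E d ≃ₗᵢ[ℝ] E d, (fun x => g (L x)) = g := by
    intro L
    have hemb := L.toHomeomorph.measurableEmbedding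
    refine huniq _ ⟨hg.comp_isometry L, ?_⟩ ?_
    · have hpre : L ⁻¹' B = B := by
        ext x
        simp [B]
      have := L.measurePreserving.setIntegral_preimage_emb hemb g B
      rw [hpre] at this
      exact this.trans hgB
    · exact (L.measurePreserving.integral_comp hemb (fun x => g x ^ 2)).trans_le hgm
  refine ⟨g, ?_, hg, fun x y hxy => ?_⟩
  · rintro rfl
    simp at hgB
  -- Reflection in the hyperplane orthogonal to `x - y` carries `x` to `y` when their norms agree.
  · have h1 := congrFun (hinv ((Submodule.span ℝ {x - y})ᗮ.reflection)) x
    rw [Submodule.reflection_sub hxy] at h1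
    exact h1.symm

/-- If a self-dual function is negative at the origin, adding a small Gaussian decreases its
radius. -/
theorem IsSelfDual.apply_zero_eq [Nontrivial (E d)] {a : ℝ} {f : E d → ℝ} (hf : IsSelfDual a f)
    (ha : 0 < a) (hmin : ∀ (s : ℝ) (g : E d → ℝ), g ≠ 0 → IsSelfDual s g → a ≤ s) : f 0 = 0 := by
  refine hf.apply_zero_nonpos.eq_of_not_lt fun hneg => ?_
  -- The largest multiple allowed: it makes `g 0 = 0`.
  set ε : ℝ := -f 0
  have hε : 0 < ε := neg_pos.2 hneg
  set g : E d → ℝ := f + fun x => ε * gaussian 1 x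
  have hgc : Continuous g := hf.continuous.add (continuous_const.mul (continuous_gaussian 1))
  have hi : Integrable (fun x : E d => ε * gaussian 1 x) := (integrable_gaussian one_pos).const_mul ε
  have hpos : ∀ x, a < ‖x‖ → 0 < g x := fun x hx =>
    add_pos_of_nonneg_of_pos (hf.nonneg x hx) (mul_pos hε (gaussian_pos 1 x))
  have hg0 : g ≠ 0 := by
    obtain ⟨x, hx⟩ := NormedSpace.exists_lt_norm ℝ (E d) a
    exact fun h => (hpos x hx).ne' (congrFun h x)
  have hgs : ∀ s, (∀ x, s < ‖x‖ → 0 ≤ g x) → IsSelfDual s g := by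
    intro s hs
    refine ⟨hf.integrable.add hi, ?_, ?_, hs⟩
    · ext y
      rw [hat_add hf.integrable hi, hf.hat_eq]
      simp only [Pi.add_apply, g]
      rw [hat_const_mul, hat_gaussian_one]
      push_cast
      rfl
    · simp [g, gaussian_zero, ε]
  have hnonneg_sphere : ∀ x, ‖x‖ = a → 0 ≤ f x := by
    intro x hx
    have hx0 : x ≠ 0 := norm_pos_iff.1 (hx ▸ ha)
    have htend : Tendsto (fun t : ℝ => f (t • x)) (𝓝[>] 1) (𝓝 (f x)) := by
      have hc : Continuous fun t : ℝ => f (t • x) :=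
        hf.continuous.comp (continuous_id.smul continuous_const)
      simpa using (hc.tendsto 1).mono_left nhdsWithin_le_nhds
    refine ge_of_tendsto htend ?_
    filter_upwards [self_mem_nhdsWithin] with t ht
    have ht : 1 < t := ht
    apply hf.nonneg
    rw [norm_smul, Real.norm_eq_abs, abs_of_pos (by linarith), hx]
    nlinarith
  -- Since `g > 0` on and outside the sphere of radius `a`, the farthest point of this compact set
  -- has norm below `a`. That norm is a smaller admissible radius for `g`.
  set C : Set (E d) := Metric.closedBall 0 a ∩ {x | g x ≤ 0}
  have hC : IsCompact C :=
    (isCompact_closedBall 0 a).inter_right (isClosed_le hgc continuous_const)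
  have hC0 : (0 : E d) ∈ C := by
    refine ⟨by simpa using ha.le, ?_⟩
    simp [g, gaussian_zero, ε]
  obtain ⟨z, hz, hzmax⟩ := hC.exists_isMaxOn ⟨0, hC0⟩ continuous_norm.continuousOn
  have hza : ‖z‖ < a := by
    have h1 : ‖z‖ ≤ a := by simpa using hz.1
    refine h1.lt_of_ne fun h => ?_
    have h2 : 0 < g z :=
      add_pos_of_nonneg_of_pos (hnonneg_sphere z h) (mul_pos hε (gaussian_pos 1 z))
    exact h2.not_ge hz.2
  refine hza.not_ge (hmin _ g hg0 (hgs _ fun x hx => ?_))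
  by_contra! hgx
  have hxC : x ∈ C := by
    refine ⟨?_, hgx.le⟩
    by_contra h
    exact (hpos x (by simpa using h)).not_gt hgx
  exact (hzmax hxC).not_gt hx

end RootUncertainty

/-! ### The sharp inequality in `[0, ∞]` -/

namespace RootUncertainty

variable {d : ℕ}

theorem A_le {u : E d → ℂ} {r : ℝ} (hr : 0 < r)
    (h : ∀ x : E d, r < ‖x‖ → 0 ≤ (u x).re ∧ (u x).im = 0) : A u ≤ ENNReal.ofReal r :=
  iInf₂_le r ⟨hr, h⟩

theorem le_A {u : E d → ℂ} {c : ℝ≥0∞}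
    (h : ∀ r : ℝ, 0 < r → (∀ x : E d, r < ‖x‖ → 0 ≤ (u x).re ∧ (u x).im = 0) →
      c ≤ ENNReal.ofReal r) : c ≤ A u :=
  le_iInf₂ fun r hr => h r hr.1 hr.2

/-- A nonzero function with nonpositive integral is not nonnegative off the origin. -/
theorem A_pos [Nontrivial (E d)] {u : E d → ℂ} (huc : Continuous u) (hu : Integrable u)
    (hint : (∫ x, u x).re ≤ 0) (hu0 : u ≠ 0) : 0 < A u := by
  refine pos_iff_ne_zero.2 fun hA => hu0 ?_
  have hoff : ∀ x : E d, x ≠ 0 → 0 ≤ (u x).re ∧ (u x).im = 0 := by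
    intro x hx
    have h1 : A u < ENNReal.ofReal ‖x‖ := by
      rw [hA]
      exact ENNReal.ofReal_pos.2 (norm_pos_iff.2 hx)
    obtain ⟨r, hr⟩ := iInf_lt_iff.1 h1
    obtain ⟨hrS, hr⟩ := iInf_lt_iff.1 hr
    exact hrS.2 x ((ENNReal.ofReal_lt_ofReal_iff (norm_pos_iff.2 hx)).1 hr)
  have hae : ∀ᵐ x : E d, 0 ≤ (u x).re ∧ (u x).im = 0 := by
    filter_upwards [(measure_eq_zero_iff_ae_notMem (μ := volume) (s := {(0 : E d)})).1
      (measure_singleton 0)] with x hx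
    exact hoff x hx
  have hre : 0 ≤ᵐ[volume] fun x => (u x).re := hae.mono fun x hx => hx.1
  have hz : ∫ x, (u x).re = 0 := by
    refine le_antisymm ?_ (integral_nonneg_of_ae hre)
    have := integral_re hu
    simp only [RCLike.re_eq_complex_re] at this
    rwa [this]
  have h2 := (integral_eq_zero_iff_of_nonneg_ae hre hu.re).1 hz
  refine (Continuous.ae_eq_iff_eq volume huc continuous_const).1 ?_
  filter_upwards [hae, h2] with x h3 h4
  exact Complex.ext h4 h3.2

theorem IsAdmissible.AReal_pos [Nontrivial (E d)] {f : E d → ℝ} (hf : IsAdmissible f) :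
    0 < AReal f := by
  refine A_pos (Complex.continuous_ofReal.comp hf.continuous) hf.integrable.ofReal ?_ fun h => ?_
  · have := hf.hat_zero_nonpos
    rwa [hat_zero, ← integral_complex_ofReal] at this
  · refine hf.ne_zero (funext fun x => ?_)
    exact Complex.ofReal_injective (congrFun h x)

theorem IsAdmissible.A_hat_pos [Nontrivial (E d)] {f : E d → ℝ} (hf : IsAdmissible f) :
    0 < A (hat f) := by
  refine A_pos (continuous_hat hf.integrable) hf.integrable_hat ?_ fun h =>
    hf.ne_zero (eq_zero_of_hat_eq_zero hf.continuous hf.integrable h)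
  have hinv := congrFun ((Complex.continuous_ofReal.comp hf.continuous).fourierInv_fourier_eq
    hf.integrable.ofReal hf.integrable_hat) 0
  rw [Real.fourierInv_eq] at hinv
  simp only [inner_zero_right, AddChar.map_zero_eq_one, one_smul, Function.comp_apply] at hinv
  have h2 : ∫ x, hat f x = (f 0 : ℂ) := hinv
  rw [h2, Complex.ofReal_re]
  exact hf.apply_zero_nonpos

theorem IsAdmissible.sq_le_mul [Nontrivial (E d)] {a : ℝ} (ha : 0 < a)
    (hmin : ∀ (s : ℝ) (g : E d → ℝ), g ≠ 0 → IsSelfDual s g → a ≤ s)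
    {f : E d → ℝ} (hf : IsAdmissible f) :
    ENNReal.ofReal a ^ 2 ≤ AReal f * A (hat f) := by
  have hstep : ∀ r : ℝ, 0 < r →
      (∀ x : E d, r < ‖x‖ → 0 ≤ ((f x : ℂ)).re ∧ ((f x : ℂ)).im = 0) →
      ENNReal.ofReal a ^ 2 ≤ ENNReal.ofReal r * A (hat f) := by
    intro r hr hfr
    have hr0 : ENNReal.ofReal r ≠ 0 := (ENNReal.ofReal_pos.2 hr).ne'
    refine (ENNReal.div_le_iff' hr0 ENNReal.ofReal_ne_top).1 (le_A fun s hs hfs => ?_)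
    rw [ENNReal.div_le_iff' hr0 ENNReal.ofReal_ne_top, ← ENNReal.ofReal_mul hr.le,
      ← ENNReal.ofReal_pow ha.le]
    apply ENNReal.ofReal_le_ofReal
    obtain ⟨g, hg0, hg⟩ := hf.exists_isSelfDual hr hs (fun x hx => (hfr x hx).1) hfs
    have h1 := pow_le_pow_left₀ ha.le (hmin _ g hg0 hg) 2
    rwa [mul_pow, Real.sq_sqrt hr.le, Real.sq_sqrt hs.le] at h1
  -- As `0 * ∞ = 0` in `ℝ≥0∞`, the infinite case needs positivity of the other factor.
  rcases eq_or_ne (A (hat f)) ∞ with htop | htop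
  · rw [htop, ENNReal.mul_top hf.AReal_pos.ne']
    exact le_top
  · rw [← ENNReal.div_le_iff hf.A_hat_pos.ne' htop]
    refine le_A fun r hr hfr => ?_
    rw [ENNReal.div_le_iff hf.A_hat_pos.ne' htop]
    exact hstep r hr hfr

theorem IsSelfDual.isAdmissible {r : ℝ} {f : E d → ℝ} (hf : IsSelfDual r f) (h0 : f ≠ 0) :
    IsAdmissible f where
  continuous := hf.continuous
  ne_zero := h0
  integrable := hf.integrable
  integrable_hat := by rw [hf.hat_eq]; exact hf.integrable.ofReal
  apply_zero_nonpos := hf.apply_zero_nonpos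
  hat_zero_nonpos := by simpa [hf.hat_eq] using hf.apply_zero_nonpos

end RootUncertainty

theorem theorem1p3 (d : ℕ) (hd : 1 ≤ d) :
    (0 < RootUncertainty.sharpConst d ∧ RootUncertainty.sharpConst d < ⊤) ∧
    (∀ g : RootUncertainty.E d → ℝ, RootUncertainty.IsAdmissible g →
      RootUncertainty.sharpConst d ^ 2 ≤
        RootUncertainty.AReal g * RootUncertainty.A (RootUncertainty.hat g)) ∧
    ∃ f : RootUncertainty.E d → ℝ,
      f ≠ 0 ∧
      RootUncertainty.IsRadial f ∧
      MeasureTheory.Integrable f ∧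
      RootUncertainty.hat f = (fun x => (f x : ℂ)) ∧
      f 0 = 0 ∧
      RootUncertainty.hat f 0 = 0 ∧
      RootUncertainty.AReal f = RootUncertainty.sharpConst d ∧
      RootUncertainty.IsAdmissible f ∧
      RootUncertainty.AReal f * RootUncertainty.A (RootUncertainty.hat f) =
        RootUncertainty.sharpConst d ^ 2 := by
  open RootUncertainty in
  have : Nonempty (Fin d) := ⟨⟨0, hd⟩⟩
  obtain ⟨a, ha, ⟨f₀, hf₀, hf₀a⟩, hmin⟩ := exists_isSelfDual_minimal (d := d)
  obtain ⟨f, hf0, hf, hrad⟩ := exists_isSelfDual_isRadial hf₀ hf₀a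
  have hadm := hf.isAdmissible hf0
  have hAhat : A (hat f) = AReal f := by rw [hf.hat_eq]; rfl
  have hle : AReal f ≤ ENNReal.ofReal a :=
    A_le ha fun x hx => ⟨by simpa using hf.nonneg x hx, Complex.ofReal_im _⟩
  have hge : ENNReal.ofReal a ≤ AReal f := by
    have h1 := hadm.sq_le_mul ha hmin
    rw [hAhat, ← sq] at h1
    exact (ENNReal.pow_le_pow_left_iff two_ne_zero).1 h1
  have hAf : AReal f = ENNReal.ofReal a := le_antisymm hle hge
  have hroot : ∀ c : ℝ≥0∞, (c ^ 2) ^ (1 / 2 : ℝ) = c := fun c => by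
    rw [← ENNReal.rpow_natCast, ← ENNReal.rpow_mul]
    norm_num
  have hconst : sharpConst d = ENNReal.ofReal a := by
    refine le_antisymm ((iInf₂_le f hadm).trans ?_) (le_iInf₂ fun g hg => ?_)
    · rw [hAhat, hAf, ← sq, hroot]
    · rw [← hroot (ENNReal.ofReal a)]
      exact ENNReal.rpow_le_rpow (IsAdmissible.sq_le_mul ha hmin hg) (by norm_num)
  have hzero : f 0 = 0 := hf.apply_zero_eq ha hmin
  refine ⟨?_, fun g hg => ?_, f, hf0, hrad, hf.integrable, hf.hat_eq, hzero, ?_, ?_, hadm, ?_⟩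
  · rw [hconst]
    exact ⟨ENNReal.ofReal_pos.2 ha, ENNReal.ofReal_lt_top⟩
  · rw [hconst]
    exact hg.sq_le_mul ha hmin
  · simp [hf.hat_eq, hzero]
  · rw [hAf, hconst]
  · rw [hAhat, hAf, hconst, sq]
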